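/- **Theorem.** For every cardinal $\kappa$ there is a hereditarily indecomposable compact Hausdorff space $X$ of weight $\kappa$ such that every nontrivial (that is, having more than one point) subcontinuum of $X$ has an essential family of cardinality $\kappa$. If $\kappa$ is infinite, then $X$ can moreover be taken to be a nontrivial continuum; in particular $X$ itself then has an essential family of cardinality $\kappa$. Here a *continuum* is a nonempty compact connected Hausdorff space. A compact Hausdorff space is *hereditarily indecomposable* if, whenever two of its subcontinua meet, one is contained in the other. The *weight* of a space is the least cardinality of a base for its topology. A *partition* between disjoint closed sets $A$ and $B$ in a space $Y$ is a set $L=Y\setminus(U\cup V)$ with $U,V$ disjoint open sets, $A\subseteq U$ and $B\subseteq V$. A family $\{(A_i,B_i):i\in I\}$ of pairs of disjoint closed subsets of $Y$ is *essential* in $Y$ if $\bigcap_{i\in I}L_i\neq\emptyset$ for every choice of partitions $L_i$ between $A_i$ and $B_i$ in $Y$ $(i\in I)$. -/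

import Mathlib

open Cardinal Set TopologicalSpace

universe u

/-- The weight of a topological space: the least cardinality of a base. -/
noncomputable def topWeight (X : Type u) [TopologicalSpace X] : Cardinal.{u} :=
  sInf {c | ∃ B : Set (Set X), IsTopologicalBasis B ∧ #B = c}

/-- A subcontinuum of a Hausdorff space: a nonempty compact connected subset. -/
def IsSubcontinuum {X : Type u} [TopologicalSpace X] (C : Set X) : Prop :=
  IsCompact C ∧ IsConnected C

/-- Hereditary indecomposability of a (not necessarily connected) compact Hausdorff space:
whenever two continua in the space meet, one is contained in the other. -/
def HereditarilyIndecomposable (X : Type u) [TopologicalSpace X] : Prop :=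
  ∀ C D : Set X, IsSubcontinuum C → IsSubcontinuum D → (C ∩ D).Nonempty → C ⊆ D ∨ D ⊆ C

/-- `L` is a partition between `A` and `B`: its complement is the union of two disjoint open
sets, one containing `A` and the other containing `B`. -/
def IsPartitionBetween {X : Type u} [TopologicalSpace X] (L A B : Set X) : Prop :=
  ∃ U V : Set X, IsOpen U ∧ IsOpen V ∧ A ⊆ U ∧ B ⊆ V ∧ Disjoint U V ∧ L = (U ∪ V)ᶜ

/-- A family of pairs of disjoint closed sets is essential if any choice of partitions, one for
each pair, has nonempty intersection. -/
structure IsEssentialFamily {X : Type u} [TopologicalSpace X] {ι : Type u}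
    (A B : ι → Set X) : Prop where
  isClosed_left : ∀ i, IsClosed (A i)
  isClosed_right : ∀ i, IsClosed (B i)
  disjoint : ∀ i, Disjoint (A i) (B i)
  nonempty_iInter : ∀ L : ι → Set X, (∀ i, IsPartitionBetween (L i) (A i) (B i)) →
    (⋂ i, L i).Nonempty

/-- `X` has an essential family consisting of `κ` many (distinct) pairs. -/
def HasEssentialFamily (X : Type u) [TopologicalSpace X] (κ : Cardinal.{u}) : Prop :=
  ∃ (ι : Type u) (A B : ι → Set X), #ι = κ ∧ Function.Injective (fun i => (A i, B i)) ∧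
    IsEssentialFamily A B

/-! For infinite κ, take S of cardinality κ and cut the space out of the cube `S → Seg` by
equations, each constraining one coordinate through polynomials in all the coordinates. There are
only κ rational polynomials and finitely supported families of them, so κ coordinates carry all the
equations (`exists_equiv_coord`). No inverse limit is needed: the equations are solved
simultaneously by `poincare_miranda`, which rests on Sperner's lemma. The free coordinate has no
equation of its own, so an arbitrary h with the right signs can be used there. Hence the solution
set meets every zero set separating the two free faces, and some component joins them
(`exists_isSubcontinuum_foldedCore`); this is X.

The relation 4t³ - 3t = q folds every bounded polynomial q. Two continua that meet without being
nested would have their common point on two different branches of the cubic, so X is hereditarily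
indecomposable.

As q rises from -1 to 1, the strip coordinate of (q, α) runs from -2 to 2, and the polynomials α i
vanish wherever it is strictly between. If partitions of the faces of the cube of q had empty
intersection, compactness and approximation would give an α without common zero on the continuum,
against the intermediate value theorem (`hasEssentialFamily_of_mem_foldedCore`).

An essential family of size κ bounds the weight below, and the positivity sets of polynomials bound
it above. For finite κ a discrete space serves. -/

/-! ### Kuhn triangulation and Sperner's lemma -/

/-- The `m`-th vertex of the Kuhn simplex with base point `v` in which the coordinate `j` is
raised at time `ρ j`. -/
def kuhnVertex {d : ℕ} (v ρ : Fin d → ℕ) (m : ℕ) : Fin d → ℕ :=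
  fun j => v j + if ρ j < m then 1 else 0

/-- The Kuhn simplices of the grid `{0, …, N}ᵈ`. -/
def kuhnSimplices (N d : ℕ) : Finset ((Fin d → ℕ) × (Fin d → ℕ)) :=
  open Classical in
  ((Fintype.piFinset fun _ => Finset.range N) ×ˢ
    (Fintype.piFinset fun _ => Finset.range d)).filter fun σ => Function.Injective σ.2

lemma mem_kuhnSimplices {N d : ℕ} {σ : (Fin d → ℕ) × (Fin d → ℕ)} :
    σ ∈ kuhnSimplices N d ↔ (∀ j, σ.1 j < N) ∧ (∀ j, σ.2 j < d) ∧ Function.Injective σ.2 := by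
  simp [kuhnSimplices, and_assoc]

/-- The vertices of the facet opposite to the `k`-th vertex. -/
def kuhnFacet {d : ℕ} (τ : (Fin d → ℕ) × (Fin d → ℕ) × ℕ) : Finset (Fin d → ℕ) :=
  ((Finset.range (d + 1)).erase τ.2.2).image (kuhnVertex τ.1 τ.2.1)

/-- The simplex on the other side of a facet. -/
def kuhnFlip {d : ℕ} (τ : (Fin d → ℕ) × (Fin d → ℕ) × ℕ) :
    (Fin d → ℕ) × (Fin d → ℕ) × ℕ :=
  if τ.2.2 = 0 then
    (fun j => if τ.2.1 j = 0 then τ.1 j + 1 else τ.1 j,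
      fun j => if τ.2.1 j = 0 then d - 1 else τ.2.1 j - 1, d)
  else if τ.2.2 = d then
    (fun j => if τ.2.1 j = d - 1 then τ.1 j - 1 else τ.1 j,
      fun j => if τ.2.1 j = d - 1 then 0 else τ.2.1 j + 1, 0)
  else
    (τ.1, fun j => if τ.2.1 j = τ.2.2 - 1 then τ.2.2 else
      if τ.2.1 j = τ.2.2 then τ.2.2 - 1 else τ.2.1 j, τ.2.2)

/-- A facet lying in the boundary of the grid `{0, …, N}ᵈ`. -/
def KuhnBoundary {d : ℕ} (N : ℕ) (τ : (Fin d → ℕ) × (Fin d → ℕ) × ℕ) : Prop :=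
  (τ.2.2 = 0 ∧ ∃ j, τ.2.1 j = 0 ∧ τ.1 j + 1 = N) ∨
    (τ.2.2 = d ∧ ∃ j, τ.2.1 j + 1 = d ∧ τ.1 j = 0)

/-- Dropping the first vertex moves the base to the second one, and the coordinate raised first is
now raised last; dropping the last vertex is the reverse move; dropping an inner vertex exchanges
two consecutive raises. -/
lemma kuhnFacet_flip {d : ℕ} {N : ℕ} {τ : (Fin d → ℕ) × (Fin d → ℕ) × ℕ}
    (hd : 0 < d) (hk : τ.2.2 ≤ d) (hσ : (τ.1, τ.2.1) ∈ kuhnSimplices N d)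
    (hb : ¬ KuhnBoundary N τ) : kuhnFacet (kuhnFlip τ) = kuhnFacet τ := by
  obtain ⟨v, ρ, k⟩ := τ
  obtain ⟨hv, hρ, hi⟩ := mem_kuhnSimplices.1 hσ
  simp only at hv hρ hi hk
  simp only [KuhnBoundary, not_or, not_and, not_exists] at hb
  obtain ⟨hb0, hbd⟩ := hb
  unfold kuhnFacet kuhnFlip
  simp only
  split_ifs with h0 h1
  · subst h0
    ext x
    simp only [Finset.mem_image, Finset.mem_erase, Finset.mem_range]
    constructor
    · rintro ⟨m, ⟨hm, hm'⟩, rfl⟩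
      refine ⟨m + 1, ⟨by omega, by omega⟩, ?_⟩
      funext j
      have := hρ j
      simp only [kuhnVertex]
      split_ifs <;> omega
    · rintro ⟨m, ⟨hm, hm'⟩, rfl⟩
      refine ⟨m - 1, ⟨by omega, by omega⟩, ?_⟩
      funext j
      have := hρ j
      simp only [kuhnVertex]
      split_ifs <;> omega
  · subst h1
    ext x
    simp only [Finset.mem_image, Finset.mem_erase, Finset.mem_range]
    constructor
    · rintro ⟨m, ⟨hm, hm'⟩, rfl⟩
      refine ⟨m - 1, ⟨by omega, by omega⟩, ?_⟩
      funext j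
      have := hρ j
      have := hbd rfl j
      simp only [kuhnVertex]
      split_ifs <;> omega
    · rintro ⟨m, ⟨hm, hm'⟩, rfl⟩
      refine ⟨m + 1, ⟨by omega, by omega⟩, ?_⟩
      funext j
      have := hρ j
      have := hbd rfl j
      simp only [kuhnVertex]
      split_ifs <;> omega
  · refine Finset.image_congr ?_
    intro m hm
    have hm1 : m ≠ k := (Finset.mem_erase.1 hm).1
    funext j
    simp only [kuhnVertex]
    split_ifs <;> omega

/-- Being off the boundary keeps the moved base below N when k = 0, and makes the truncated
subtraction genuine when k = d. -/
lemma kuhnFlip_mem {d : ℕ} {N : ℕ} {τ : (Fin d → ℕ) × (Fin d → ℕ) × ℕ}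
    (hd : 0 < d) (hk : τ.2.2 ≤ d) (hσ : (τ.1, τ.2.1) ∈ kuhnSimplices N d)
    (hb : ¬ KuhnBoundary N τ) :
    ((kuhnFlip τ).1, (kuhnFlip τ).2.1) ∈ kuhnSimplices N d ∧ (kuhnFlip τ).2.2 ≤ d ∧
      ¬ KuhnBoundary N (kuhnFlip τ) ∧ kuhnFlip τ ≠ τ ∧ kuhnFlip (kuhnFlip τ) = τ := by
  obtain ⟨v, ρ, k⟩ := τ
  rw [mem_kuhnSimplices] at hσ ⊢
  obtain ⟨hv, hρ, hi⟩ := hσ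
  simp only at hv hρ hi hk
  simp only [KuhnBoundary, not_or, not_and, not_exists] at hb
  obtain ⟨hb0, hbd⟩ := hb
  have hsurj : ∀ m < d, ∃ j, ρ j = m := by
    intro m hm
    have : Function.Surjective (fun j => (⟨ρ j, hρ j⟩ : Fin d)) :=
      Finite.surjective_of_injective (fun a b h => hi (by simpa using h))
    obtain ⟨j, hj⟩ := this ⟨m, hm⟩
    exact ⟨j, by simpa using hj⟩
  rcases Nat.eq_zero_or_pos k with rfl | hk0
  · have hd0 : d ≠ 0 := hd.ne'
    have e : kuhnFlip (v, ρ, 0) = (fun j => if ρ j = 0 then v j + 1 else v j,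
      fun j => if ρ j = 0 then d - 1 else ρ j - 1, d) := by simp [kuhnFlip]
    rw [e]
    refine ⟨⟨fun j => ?_, fun j => ?_, fun a b hab => hi ?_⟩, le_rfl, ?_, ?_, ?_⟩
    · have := hb0 rfl j; have := hv j; simp only; split_ifs <;> omega
    · have := hρ j; simp only; split_ifs <;> omega
    · have := hρ a; have := hρ b; simp only at hab; split_ifs at hab <;> omega
    · rintro (⟨h, -⟩ | ⟨-, j, h, h'⟩)
      · exact hd0 h
      · have := hρ j; simp only at h h'; split_ifs at h h'; omega
    · intro h
      exact hd0 (congrArg (fun x => x.2.2) h)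
    · simp only [kuhnFlip, if_neg hd0, if_true]
      refine Prod.ext (funext fun j => ?_) (Prod.ext (funext fun j => ?_) rfl) <;>
      · have := hρ j; simp only; split_ifs <;> omega
  rcases eq_or_lt_of_le hk with rfl | hkd
  · have e : kuhnFlip (v, ρ, k) = (fun j => if ρ j = k - 1 then v j - 1 else v j,
      fun j => if ρ j = k - 1 then 0 else ρ j + 1, 0) := by simp [kuhnFlip, hd.ne']
    rw [e]
    refine ⟨⟨fun j => ?_, fun j => ?_, fun a b hab => hi ?_⟩, Nat.zero_le _, ?_, ?_, ?_⟩
    · have := hv j; simp only; split_ifs <;> omega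
    · have := hρ j; simp only; split_ifs <;> omega
    · have := hρ a; have := hρ b; simp only at hab; split_ifs at hab <;> omega
    · rintro (⟨-, j, h, h'⟩ | ⟨h, -⟩)
      · have := hbd rfl j; have := hv j; simp only at h h'; split_ifs at h h'; omega
      · exact hd.ne h
    · intro h
      exact hd.ne (congrArg (fun x => x.2.2) h)
    · simp only [kuhnFlip, if_true]
      refine Prod.ext (funext fun j => ?_) (Prod.ext (funext fun j => ?_) rfl)
      · have := hbd rfl j
        by_cases hj : ρ j = k - 1
        · simp only [hj, if_true]; omega
        · simp [hj]
      · by_cases hj : ρ j = k - 1 <;> simp [hj]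
  · have e : ∀ ρ : Fin d → ℕ, kuhnFlip (v, ρ, k) = (v, fun j => if ρ j = k - 1 then k else
        if ρ j = k then k - 1 else ρ j, k) := by
      intro ρ
      simp [kuhnFlip, hk0.ne', hkd.ne]
    rw [e]
    refine ⟨⟨hv, fun j => ?_, fun a b hab => hi ?_⟩, hk, ?_, ?_, ?_⟩
    · have := hρ j; simp only; split_ifs <;> omega
    · have := hρ a; have := hρ b; simp only at hab; split_ifs at hab <;> omega
    · rintro (⟨h, -⟩ | ⟨h, -⟩)
      · exact hk0.ne' h
      · exact hkd.ne h
    · intro h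
      obtain ⟨j, hj⟩ := hsurj k hkd
      have := congrFun (congrArg (fun x => x.2.1) h) j
      simp only at this
      split_ifs at this <;> omega
    · rw [e]
      refine Prod.ext rfl (Prod.ext (funext fun j => ?_) rfl)
      simp only; split_ifs <;> omega

/-- A labelling of `{0, …, n}` by elements of `{0, …, n}` omits no label iff an odd number of
the sets obtained by deleting one point carry exactly the labels `0, …, n - 1`. -/
lemma card_doors {n : ℕ} (f : ℕ → ℕ) (hf : ∀ k < n + 1, f k ≤ n) :
    ((((Finset.range (n + 1)).filter fun k =>
      ((Finset.range (n + 1)).erase k).image f = Finset.range n).card : ℕ) : ZMod 2) =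
      if (Finset.range (n + 1)).image f = Finset.range (n + 1) then 1 else 0 := by
  split_ifs with h
  -- The labels are a bijection, so only deleting the point labelled n works.
  · have hinj : Set.InjOn f (Finset.range (n + 1)) := by
      apply Finset.injOn_of_card_image_eq
      rw [h]
    obtain ⟨k, hk, hfk⟩ : ∃ k ∈ Finset.range (n + 1), f k = n := by
      have : n ∈ (Finset.range (n + 1)).image f := by rw [h]; simp
      simpa using this
    have : ((Finset.range (n + 1)).filter fun k =>
      ((Finset.range (n + 1)).erase k).image f = Finset.range n) = {k} := by
      ext m
      simp only [Finset.mem_filter, Finset.mem_singleton]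
      constructor
      · rintro ⟨hm, hm'⟩
        by_contra hne
        have : n ∈ Finset.range n := by
          rw [← hm']
          exact Finset.mem_image.2 ⟨k, Finset.mem_erase.2 ⟨fun h => hne h.symm, hk⟩, hfk⟩
        simp at this
      · rintro rfl
        refine ⟨hk, ?_⟩
        have hsub : ((Finset.range (n + 1)).erase m).image f ⊆ Finset.range n := by
          intro x hx
          obtain ⟨p, hp, rfl⟩ := Finset.mem_image.1 hx
          obtain ⟨hp1, hp2⟩ := Finset.mem_erase.1 hp
          rw [Finset.mem_range]
          refine lt_of_le_of_ne (hf p (by simpa using hp2)) fun hpn => hp1 (hinj hp2 hk ?_)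
          rw [hpn, hfk]
        refine Finset.eq_of_subset_of_card_le hsub ?_
        rw [Finset.card_image_of_injOn (hinj.mono (Finset.erase_subset _ _)),
          Finset.card_erase_of_mem hk]
        simp
    rw [this]; simp
  · by_cases hne : ∃ k ∈ Finset.range (n + 1),
      ((Finset.range (n + 1)).erase k).image f = Finset.range n
    · obtain ⟨k, hk, hk'⟩ := hne
      have hinj : Set.InjOn f ((Finset.range (n + 1)).erase k) := by
        apply Finset.injOn_of_card_image_eq
        rw [hk', Finset.card_erase_of_mem hk]; simp
      have hfk : f k < n := by
        refine lt_of_le_of_ne (hf k (by simpa using hk)) fun hfk => h ?_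
        have := congrArg (Finset.image f) (Finset.insert_erase hk)
        rw [Finset.image_insert, hk', hfk] at this
        rw [← this, Finset.range_add_one]
      obtain ⟨l, hl, hfl⟩ : ∃ l ∈ (Finset.range (n + 1)).erase k, f l = f k := by
        have : f k ∈ ((Finset.range (n + 1)).erase k).image f := by rw [hk']; simpa using hfk
        simpa only [Finset.mem_image] using this
      -- The label of k recurs exactly once, at l; deleting k or l works and nothing else does, an
      -- even count.
      have hlk : l ≠ k := (Finset.mem_erase.1 hl).1
      have hl' : l ∈ Finset.range (n + 1) := (Finset.mem_erase.1 hl).2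
      have : ((Finset.range (n + 1)).filter fun k =>
        ((Finset.range (n + 1)).erase k).image f = Finset.range n) = {k, l} := by
        ext m
        simp only [Finset.mem_filter, Finset.mem_singleton, Finset.mem_insert]
        constructor
        · rintro ⟨hm, hm'⟩
          by_contra! hne
          have hmk : m ∈ (Finset.range (n + 1)).erase k := Finset.mem_erase.2 ⟨hne.1, hm⟩
          have : f m ∈ ((Finset.range (n + 1)).erase m).image f := by
            rw [hm', ← hk']; exact Finset.mem_image_of_mem f hmk
          obtain ⟨p, hp, hpm⟩ := Finset.mem_image.1 this
          obtain ⟨hp1, hp2⟩ := Finset.mem_erase.1 hp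
          by_cases hpk : p = k
          · subst hpk
            exact hne.2 (hinj hmk hl (by rw [hfl, hpm]))
          · exact hp1 (hinj (Finset.mem_erase.2 ⟨hpk, hp2⟩) hmk hpm)
        · rintro (rfl | rfl)
          · exact ⟨hk, hk'⟩
          · refine ⟨hl', ?_⟩
            rw [← hk']
            apply Finset.Subset.antisymm
            · intro x hx
              obtain ⟨p, hp, rfl⟩ := Finset.mem_image.1 hx
              obtain ⟨hp1, hp2⟩ := Finset.mem_erase.1 hp
              by_cases hpk : p = k
              · subst hpk; rw [← hfl]; exact Finset.mem_image_of_mem f hl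
              · exact Finset.mem_image_of_mem f (Finset.mem_erase.2 ⟨hpk, hp2⟩)
            · intro x hx
              obtain ⟨p, hp, rfl⟩ := Finset.mem_image.1 hx
              obtain ⟨hp1, hp2⟩ := Finset.mem_erase.1 hp
              by_cases hpl : p = m
              · subst hpl; rw [hfl]
                exact Finset.mem_image_of_mem f (Finset.mem_erase.2 ⟨hlk.symm, hk⟩)
              · exact Finset.mem_image_of_mem f (Finset.mem_erase.2 ⟨hpl, hp2⟩)
      rw [this, Finset.card_pair hlk.symm]
      rfl
    · push Not at hne
      rw [Finset.filter_false_of_mem hne]; simp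

lemma snoc_init_of_eq {n c : ℕ} {f : Fin (n + 1) → ℕ} (h : f (Fin.last n) = c) :
    (Fin.snoc (Fin.init f) c : Fin (n + 1) → ℕ) = f := by
  subst h
  exact Fin.snoc_init_self f

/-- The Kuhn simplices all of whose labels occur. -/
def fullSimplices (N : ℕ) {d : ℕ} (l : (Fin d → ℕ) → ℕ) :
    Finset ((Fin d → ℕ) × (Fin d → ℕ)) :=
  (kuhnSimplices N d).filter fun σ =>
    (Finset.range (d + 1)).image (fun m => l (kuhnVertex σ.1 σ.2 m)) = Finset.range (d + 1)

/-- **Sperner's lemma** for the Kuhn triangulation of a cubical grid. -/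
theorem card_fullSimplices (N : ℕ) (hN : 0 < N) : ∀ (d : ℕ) (l : (Fin d → ℕ) → ℕ),
    (∀ x, l x ≤ d) → (∀ x (j : Fin d), x j = 0 → l x ≤ j) →
    (∀ x (j : Fin d), x j = N → l x ≠ j) →
    ((fullSimplices N l).card : ZMod 2) = 1
  | 0, l, h, _, _ => by
    have : fullSimplices N l = {(Fin.elim0, Fin.elim0)} := by
      ext σ
      have h0 : ∀ x, l x = 0 := fun x => Nat.le_zero.1 (h x)
      have hs : σ = (Fin.elim0, Fin.elim0) := Subsingleton.elim _ _
      simp only [fullSimplices, Finset.mem_filter, mem_kuhnSimplices, Finset.mem_singleton, hs]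
      simp [h0, Function.injective_of_subsingleton]
    rw [this]; simp
  | n + 1, l, h, h0, h1 => by
    classical
    set Doors : Finset ((Fin (n + 1) → ℕ) × (Fin (n + 1) → ℕ) × ℕ) :=
      ((kuhnSimplices N (n + 1) ×ˢ Finset.range (n + 2)).map
        (Equiv.prodAssoc _ _ _).toEmbedding).filter
        fun τ => (kuhnFacet τ).image l = Finset.range (n + 1) with hDoors
    have mem_Doors : ∀ τ, τ ∈ Doors ↔ ((τ.1, τ.2.1) ∈ kuhnSimplices N (n + 1) ∧ τ.2.2 ≤ n + 1) ∧
        (kuhnFacet τ).image l = Finset.range (n + 1) := by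
      rintro ⟨v, ρ, k⟩
      simp [hDoors, Nat.lt_succ_iff]
    have e1 : ((fullSimplices N l).card : ZMod 2) = (Doors.card : ZMod 2) := by
      rw [hDoors, Finset.card_filter, Finset.sum_map, Finset.sum_product, fullSimplices,
        Finset.card_filter, Nat.cast_sum, Nat.cast_sum]
      refine Finset.sum_congr rfl fun σ _ => ?_
      have := card_doors (n := n + 1) (fun m => l (kuhnVertex σ.1 σ.2 m)) (fun k _ => h _)
      rw [Finset.card_filter] at this
      simp only [kuhnFacet, Finset.image_image, Equiv.coe_toEmbedding, Equiv.prodAssoc_apply]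
      push_cast at this ⊢
      exact this.symm
    -- Interior doors cancel in pairs, being seen from both sides.
    have e2 : ∑ τ ∈ Doors.filter (fun τ => ¬ KuhnBoundary N τ), (1 : ZMod 2) = 0 := by
      refine Finset.sum_involution (fun τ _ => kuhnFlip τ) ?_ ?_ ?_ ?_
      · intros; rfl
      · intro τ hτ _
        obtain ⟨hτ, hb⟩ := Finset.mem_filter.1 hτ
        obtain ⟨⟨hs, hk⟩, hl⟩ := (mem_Doors τ).1 hτ
        exact (kuhnFlip_mem n.succ_pos hk hs hb).2.2.2.1
      · intro τ hτ
        obtain ⟨hτ, hb⟩ := Finset.mem_filter.1 hτ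
        obtain ⟨⟨hs, hk⟩, hl⟩ := (mem_Doors τ).1 hτ
        obtain ⟨a1, a2, a3, -⟩ := kuhnFlip_mem n.succ_pos hk hs hb
        refine Finset.mem_filter.2 ⟨(mem_Doors _).2 ⟨⟨a1, a2⟩, ?_⟩, a3⟩
        rw [kuhnFacet_flip n.succ_pos hk hs hb, hl]
      · intro τ hτ
        obtain ⟨hτ, hb⟩ := Finset.mem_filter.1 hτ
        obtain ⟨⟨hs, hk⟩, hl⟩ := (mem_Doors τ).1 hτ
        exact (kuhnFlip_mem n.succ_pos hk hs hb).2.2.2.2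
    have e3 : (Doors.filter (fun τ => KuhnBoundary N τ)).card =
        (fullSimplices N (fun x : Fin n → ℕ => l (Fin.snoc x 0))).card := by
      -- The last coordinate is raised last, so all vertices but the final one stay in its zero
      -- face.
      have hvert : ∀ (v ρ : Fin n → ℕ) (m : ℕ), m < n + 1 →
          kuhnVertex (Fin.snoc v 0 : Fin (n + 1) → ℕ) (Fin.snoc ρ n) m =
            Fin.snoc (kuhnVertex v ρ m) 0 := by
        intro v ρ m hm
        funext j
        refine Fin.lastCases ?_ (fun j => ?_) j
        · simp [kuhnVertex]; omega
        · simp [kuhnVertex]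
      have hfac : ∀ (v ρ : Fin n → ℕ),
          (kuhnFacet ((Fin.snoc v 0 : Fin (n + 1) → ℕ), (Fin.snoc ρ n : Fin (n + 1) → ℕ),
            n + 1)).image l =
          (Finset.range (n + 1)).image fun m => l (Fin.snoc (kuhnVertex v ρ m) 0) := by
        intro v ρ
        have : (Finset.range (n + 1 + 1)).erase (n + 1) = Finset.range (n + 1) := by
          ext x; simp; omega
        simp only [kuhnFacet, this, Finset.image_image]
        refine Finset.image_congr fun m hm => ?_
        have hm' : m < n + 1 := by simpa using hm
        simp only [Function.comp, hvert v ρ m hm']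
      have hbdry : ∀ τ ∈ Doors.filter (fun τ => KuhnBoundary N τ),
          τ.2.2 = n + 1 ∧ τ.2.1 (Fin.last n) = n ∧ τ.1 (Fin.last n) = 0 := by
        rintro ⟨v, ρ, k⟩ hτ
        obtain ⟨hτ, hb⟩ := Finset.mem_filter.1 hτ
        obtain ⟨⟨hs, hk⟩, hl⟩ := (mem_Doors _).1 hτ
        rcases hb with ⟨hk0, j, hj, hj'⟩ | ⟨hkd, j, hj, hj'⟩
        -- A facet in the face x j = N lacks the label j, which a door must carry.
        · exfalso
          have : (j : ℕ) ∈ (kuhnFacet (v, ρ, k)).image l := by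
            rw [hl]; exact Finset.mem_range.2 j.2
          simp only [kuhnFacet, Finset.mem_image, Finset.mem_erase] at this hk0 hj hj'
          obtain ⟨_, ⟨m, ⟨hm, -⟩, rfl⟩, hm'⟩ := this
          refine h1 _ j ?_ hm'
          simp only [kuhnVertex, hj]
          rw [if_pos (by omega), hj']
        -- In the face x j = 0 labels are at most j, and a door carries n, so j is the last
        -- coordinate.
        · have : n ∈ (kuhnFacet (v, ρ, k)).image l := by rw [hl]; simp
          simp only [kuhnFacet, Finset.mem_image, Finset.mem_erase, Finset.mem_range]
            at this hkd hj hj'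
          obtain ⟨_, ⟨m, ⟨hm, hmn⟩, rfl⟩, hm'⟩ := this
          have hle : n ≤ j := by
            refine hm'.symm.le.trans (h0 _ j ?_)
            simp only [kuhnVertex, hj']
            rw [if_neg (by omega)]
          obtain rfl : j = Fin.last n := Fin.ext (by have := j.2; simp; omega)
          exact ⟨hkd, by simp only; omega, hj'⟩
      refine Finset.card_nbij' (fun τ => (Fin.init τ.1, Fin.init τ.2.1))
        (fun σ => (Fin.snoc σ.1 0, Fin.snoc σ.2 n, n + 1)) ?_ ?_ ?_ ?_
      · rintro ⟨v, ρ, k⟩ hτ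
        obtain ⟨rfl, e1, e2⟩ := hbdry _ hτ
        simp only at e1 e2
        obtain ⟨hτ, hb⟩ := Finset.mem_filter.1 hτ
        obtain ⟨⟨hs, hk⟩, hl⟩ := (mem_Doors _).1 hτ
        obtain ⟨hv, hρ, hi⟩ := mem_kuhnSimplices.1 hs
        refine Finset.mem_filter.2 ⟨mem_kuhnSimplices.2 ⟨fun j => hv _, fun j => ?_, ?_⟩, ?_⟩
        · have h1 := hρ j.castSucc
          have h2 : ρ j.castSucc ≠ ρ (Fin.last n) := fun h => (Fin.castSucc_lt_last j).ne (hi h)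
          simp only [Fin.init] at h1 ⊢
          omega
        · exact hi.comp (Fin.castSucc_injective n)
        · have := hfac (Fin.init v) (Fin.init ρ)
          rw [snoc_init_of_eq e2, snoc_init_of_eq e1, hl] at this
          exact this.symm
      · rintro ⟨v, ρ⟩ hσ
        obtain ⟨hs, hl⟩ := Finset.mem_filter.1 hσ
        obtain ⟨hv, hρ, hi⟩ := mem_kuhnSimplices.1 hs
        simp only at hv hρ hi
        refine Finset.mem_filter.2 ⟨(mem_Doors _).2 ⟨⟨mem_kuhnSimplices.2 ⟨?_, ?_, ?_⟩, le_rfl⟩,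
          ?_⟩, Or.inr ⟨rfl, Fin.last n, by simp, by simp⟩⟩
        · intro j
          refine Fin.lastCases ?_ (fun j => ?_) j
          · simpa using hN
          · simpa using hv j
        · intro j
          refine Fin.lastCases ?_ (fun j => ?_) j
          · simp
          · simpa using (hρ j).trans n.lt_succ_self
        · intro a b
          refine Fin.lastCases ?_ (fun a => ?_) a <;> refine Fin.lastCases ?_ (fun b => ?_) b
          · simp
          · simpa using fun h => absurd h (hρ b).ne'
          · simpa using fun h => absurd h (hρ a).ne
          · simpa using fun h => hi h
        · rw [hfac]; exact hl
      · rintro ⟨v, ρ, k⟩ hτ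
        obtain ⟨rfl, e1, e2⟩ := hbdry _ hτ
        simp only at e1 e2
        refine Prod.ext ?_ (Prod.ext ?_ rfl)
        · exact snoc_init_of_eq e2
        · exact snoc_init_of_eq e1
      · rintro ⟨v, ρ⟩ hσ
        simp
    have ih := card_fullSimplices N hN n (fun x => l (Fin.snoc x 0))
      (fun x => by simpa using h0 (Fin.snoc x 0) (Fin.last n) (by simp))
      (fun x j hj => by simpa using h0 (Fin.snoc x 0) j.castSucc (by simpa using hj))
      (fun x j hj => by simpa using h1 (Fin.snoc x 0) j.castSucc (by simpa using hj))
    rw [e1, ← Finset.card_filter_add_card_filter_not (s := Doors) (KuhnBoundary N), e3,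
      Nat.cast_add, ih]
    simp only [Finset.sum_const, nsmul_eq_mul, mul_one] at e2
    rw [e2, add_zero]

/-! ### The Poincaré–Miranda theorem -/

/-- The interval over which all coordinates vary. -/
abbrev Seg : Type := Icc (-2 : ℝ) 2

/-- The midpoint of the interval. -/
def segZero : Seg := ⟨0, by norm_num, by norm_num⟩

/-- The grid point with index `x` in the subdivision of the cube into `Nᵈ` cubes. -/
noncomputable def gridPoint {d : ℕ} (N : ℕ) (x : Fin d → ℕ) : Fin d → Seg :=
  fun j => projIcc (-2) 2 (by norm_num) (-2 + 4 * (x j / N : ℝ))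

lemma dist_gridPoint_le {d N : ℕ} (hN : 0 < N) (v ρ : Fin d → ℕ) (m m' : ℕ) :
    dist (gridPoint N (kuhnVertex v ρ m)) (gridPoint N (kuhnVertex v ρ m')) ≤ 4 / N := by
  have hN' : (0 : ℝ) < N := by exact_mod_cast hN
  rw [dist_pi_le_iff (by positivity)]
  intro j
  rw [Subtype.dist_eq, Real.dist_eq]
  refine (abs_projIcc_sub_projIcc _).trans ?_
  have : (-2 + 4 * ((kuhnVertex v ρ m j : ℕ) / N : ℝ) - (-2 + 4 * ((kuhnVertex v ρ m' j : ℕ) / N : ℝ)))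
      = 4 / N * (((kuhnVertex v ρ m j : ℕ) : ℝ) - (kuhnVertex v ρ m' j : ℕ)) := by
    field_simp; ring
  rw [this, abs_mul, abs_of_pos (by positivity)]
  refine mul_le_of_le_one_right (by positivity) ?_
  simp only [kuhnVertex]
  split_ifs <;> simp

/-- Label a grid point by its first low coordinate, or d if there is none. In a fully labelled
simplex the vertex labelled d has every h j nonnegative, while the vertex labelled j has h j
nonpositive; uniform continuity does the rest. -/
lemma exists_forall_abs_lt {d : ℕ} (h : Fin d → (Fin d → Seg) → ℝ) (hc : ∀ j, Continuous (h j))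
    (h0 : ∀ j w, (w j : ℝ) = -2 → h j w ≤ 0) (h1 : ∀ j w, (w j : ℝ) = 2 → 0 ≤ h j w)
    {ε : ℝ} (hε : 0 < ε) : ∃ w, ∀ j, |h j w| < ε := by
  classical
  have huc : UniformContinuous (fun w j => h j w) :=
    CompactSpace.uniformContinuous_of_continuous (continuous_pi hc)
  obtain ⟨δ, hδ, hδ'⟩ := Metric.uniformContinuous_iff.1 huc ε hε
  obtain ⟨N, hN⟩ := exists_nat_gt (4 / δ)
  have hNpos : (0 : ℝ) < N := lt_trans (by positivity) hN
  have hN0 : 0 < N := by exact_mod_cast hNpos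
  have hNδ : 4 / (N : ℝ) < δ := by
    rw [div_lt_iff₀ hNpos]; rw [div_lt_iff₀ hδ] at hN; linarith
  -- On the faces position overrides the sign, since h j may vanish there and Sperner's boundary
  -- conditions must hold exactly.
  let low : (Fin d → ℕ) → Fin d → Prop := fun x j =>
    x j ≠ N ∧ (x j = 0 ∨ h j (gridPoint N x) ≤ 0)
  have hlow : ∀ x j, low x j → h j (gridPoint N x) ≤ 0 := by
    rintro x j ⟨-, hx | hx⟩
    · apply h0
      simp [gridPoint, hx, projIcc]
    · exact hx
  have hhigh : ∀ x j, ¬ low x j → 0 ≤ h j (gridPoint N x) := by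
    intro x j hx
    by_cases hxN : x j = N
    · apply h1
      simp [gridPoint, hxN, projIcc, hNpos.ne']
      norm_num
    · by_contra hneg
      exact hx ⟨hxN, Or.inr (not_le.1 hneg).le⟩
  have hex : ∀ x : Fin d → ℕ, ∃ k, k = d ∨ ∃ hk : k < d, low x ⟨k, hk⟩ := fun x => ⟨d, Or.inl rfl⟩
  let l : (Fin d → ℕ) → ℕ := fun x => Nat.find (hex x)
  have hcard := card_fullSimplices N hN0 d l (fun x => Nat.find_min' _ (Or.inl rfl))
    (fun x j hj => Nat.find_min' _ (Or.inr ⟨j.2, by simp only [Fin.eta]; exact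
      ⟨by omega, Or.inl hj⟩⟩))
    (fun x j hj hl => by
      rcases Nat.find_spec (hex x) with h' | ⟨h', hlow⟩
      · exact j.2.ne (hl.symm.trans h')
      · have : (⟨Nat.find (hex x), h'⟩ : Fin d) = j := Fin.ext hl
        rw [this] at hlow
        exact hlow.1 hj)
  have hne : (fullSimplices N l).Nonempty := by
    rw [Finset.nonempty_iff_ne_empty]
    intro h
    rw [h] at hcard
    simp at hcard
  obtain ⟨⟨v, ρ⟩, hσ⟩ := hne
  have hfull := (Finset.mem_filter.1 hσ).2
  simp only at hfull
  have hlab : ∀ k ≤ d, ∃ m, l (kuhnVertex v ρ m) = k := by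
    intro k hk
    have : k ∈ Finset.range (d + 1) := Finset.mem_range.2 (by omega)
    rw [← hfull] at this
    obtain ⟨m, -, hm⟩ := Finset.mem_image.1 this
    exact ⟨m, hm⟩
  obtain ⟨m, hm⟩ := hlab d le_rfl
  refine ⟨gridPoint N (kuhnVertex v ρ m), fun j => ?_⟩
  have hpos : 0 ≤ h j (gridPoint N (kuhnVertex v ρ m)) := by
    apply hhigh
    intro hl
    have : l (kuhnVertex v ρ m) ≤ j := Nat.find_min' _ (Or.inr ⟨j.2, hl⟩)
    have := j.2
    omega
  obtain ⟨m', hm'⟩ := hlab j j.2.le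
  have hneg : h j (gridPoint N (kuhnVertex v ρ m')) ≤ 0 := by
    apply hlow
    rcases Nat.find_spec (hex (kuhnVertex v ρ m')) with h' | ⟨h', hlow⟩
    · exact absurd (hm'.symm.trans h') j.2.ne
    · have : (⟨Nat.find (hex (kuhnVertex v ρ m')), h'⟩ : Fin d) = j := Fin.ext hm'
      rwa [this] at hlow
  have hd := hδ' ((dist_gridPoint_le hN0 v ρ m m').trans_lt hNδ)
  have hd := (dist_le_pi_dist _ _ j).trans_lt hd
  rw [Real.dist_eq] at hd
  rw [abs_of_nonneg hpos]
  exact lt_of_le_of_lt (by linarith) (lt_of_le_of_lt (le_abs_self _) hd)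

/-- **Poincaré–Miranda theorem** on a finite-dimensional cube. -/
theorem poincare_miranda_fin {d : ℕ} (h : Fin d → (Fin d → Seg) → ℝ) (hc : ∀ j, Continuous (h j))
    (h0 : ∀ j w, (w j : ℝ) = -2 → h j w ≤ 0) (h1 : ∀ j w, (w j : ℝ) = 2 → 0 ≤ h j w) :
    ∃ w, ∀ j, h j w = 0 := by
  have hcn : Continuous (fun w => ‖fun j => h j w‖) := (continuous_pi hc).norm
  obtain ⟨w, -, hw⟩ := isCompact_univ.exists_isMinOn (⟨fun _ => segZero, mem_univ _⟩ : (Set.univ : Set (Fin d → Seg)).Nonempty)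
    hcn.continuousOn
  refine ⟨w, fun j => ?_⟩
  have : ‖fun j => h j w‖ ≤ 0 := by
    refine le_of_forall_pos_lt_add fun ε hε => ?_
    obtain ⟨b, hb⟩ := exists_forall_abs_lt h hc h0 h1 hε
    rw [zero_add]
    refine (hw (mem_univ b)).trans_lt ?_
    exact (pi_norm_lt_iff hε).2 hb
  simpa using ((norm_le_pi_norm (fun j => h j w) j).trans this)

/-- **Poincaré–Miranda theorem** on a Tychonoff cube. -/
theorem poincare_miranda {S : Type*} (h : S → (S → Seg) → ℝ) (hc : ∀ j, Continuous (h j))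
    (h0 : ∀ j w, (w j : ℝ) = -2 → h j w ≤ 0) (h1 : ∀ j w, (w j : ℝ) = 2 → 0 ≤ h j w) :
    ∃ w, ∀ j, h j w = 0 := by
  classical
  have key : (Set.univ ∩ ⋂ j, {w | h j w = 0}).Nonempty := by
    refine isCompact_univ.inter_iInter_nonempty _
      (fun j => isClosed_eq (hc j) continuous_const) fun F => ?_
    let E : (Fin F.card → Seg) → S → Seg := fun x s =>
      if hs : s ∈ F then x (F.equivFin ⟨s, hs⟩) else segZero
    have hE : Continuous E := by
      refine continuous_pi fun s => ?_
      by_cases hs : s ∈ F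
      · simp only [E, hs, dif_pos]; exact continuous_apply _
      · simp only [E, hs]; exact continuous_const
    have hEF : ∀ x k, E x (F.equivFin.symm k) = x k := by
      intro x k
      simp [E]
    obtain ⟨x, hx⟩ := poincare_miranda_fin (fun k x => h (F.equivFin.symm k) (E x))
      (fun k => (hc _).comp hE) (fun k x hk => h0 _ _ (by rw [hEF]; exact hk))
      (fun k x hk => h1 _ _ (by rw [hEF]; exact hk))
    refine ⟨E x, mem_univ _, mem_iInter₂.2 fun s hs => ?_⟩
    have := hx (F.equivFin ⟨s, hs⟩)
    simpa using this
  obtain ⟨w, -, hw⟩ := key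
  exact ⟨w, fun j => mem_iInter.1 hw j⟩

/-! ### Approximation by rational polynomials -/

/-- The rational polynomial functions on the cube. -/
noncomputable def polyFun {S : Type*} : MvPolynomial S ℚ →ₐ[ℚ] C(S → Seg, ℝ) :=
  MvPolynomial.aeval fun s => ⟨fun w => (w s : ℝ), by fun_prop⟩

/-- Rational constants are dense, so the closure of the rational polynomials is a real algebra and
Stone–Weierstrass applies. Rational coefficients keep the number of polynomials down to the number
of variables. -/
theorem exists_polyFun_near {S : Type*} (f : C(S → Seg, ℝ)) {ε : ℝ} (hε : 0 < ε) :
    ∃ q : MvPolynomial S ℚ, ∀ w, |polyFun q w - f w| < ε := by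
  let R : Subring C(S → Seg, ℝ) := (polyFun (S := S)).toRingHom.range.topologicalClosure
  have hsub : ∀ q : MvPolynomial S ℚ, polyFun q ∈ R := fun q =>
    Subring.le_topologicalClosure _ ⟨q, rfl⟩
  let A : Subalgebra ℝ C(S → Seg, ℝ) :=
    { R with
      algebraMap_mem' := by
        intro r
        have hr : r ∈ closure (Set.range ((↑) : ℚ → ℝ)) := Rat.isDenseEmbedding_coe_real.dense r
        refine map_mem_closure (f := fun r : ℝ => algebraMap ℝ C(S → Seg, ℝ) r)
          ContinuousMap.continuous_const' hr ?_
        rintro _ ⟨x, rfl⟩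
        refine ⟨MvPolynomial.C x, ?_⟩
        ext w
        simp [polyFun] }
  have hsep : A.SeparatesPoints := by
    intro x y hxy
    obtain ⟨s, hs⟩ := Function.ne_iff.1 hxy
    refine ⟨_, ⟨polyFun (MvPolynomial.X s), hsub _, rfl⟩, ?_⟩
    simp only [polyFun, MvPolynomial.aeval_X, ContinuousMap.coe_mk]
    exact fun h => hs (Subtype.ext h)
  have htop := ContinuousMap.subalgebra_topologicalClosure_eq_top_of_separatesPoints A hsep
  have hf : f ∈ closure (A : Set C(S → Seg, ℝ)) := by
    have : f ∈ A.topologicalClosure := by rw [htop]; trivial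
    exact this
  have hA : (A : Set C(S → Seg, ℝ)) = closure (Set.range polyFun) := rfl
  rw [hA, closure_closure] at hf
  obtain ⟨_, ⟨q, rfl⟩, hq⟩ := Metric.mem_closure_iff.1 hf ε hε
  refine ⟨q, fun w => ?_⟩
  rw [← Real.dist_eq, dist_comm]
  exact (ContinuousMap.dist_apply_le_dist w).trans_lt hq

/-! ### Essential families and weight -/

lemma exists_isPartitionBetween {X : Type u} [TopologicalSpace X] [NormalSpace X] {A B : Set X}
    (hA : IsClosed A) (hB : IsClosed B) (h : Disjoint A B) : ∃ L, IsPartitionBetween L A B := by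
  obtain ⟨U, V, hU, hV, hAU, hBV, hUV⟩ := normal_separation hA hB h
  exact ⟨_, U, V, hU, hV, hAU, hBV, hUV, rfl⟩

lemma isPartitionBetween_level {X : Type u} [TopologicalSpace X] {A B : Set X} {f : X → ℝ}
    (hf : Continuous f) (c : ℝ) (hA : ∀ x ∈ A, f x < c) (hB : ∀ x ∈ B, c < f x) :
    IsPartitionBetween {x | f x = c} A B := by
  refine ⟨{x | f x < c}, {x | c < f x}, isOpen_lt hf continuous_const,
    isOpen_lt continuous_const hf, hA, hB, ?_, ?_⟩
  · exact Set.disjoint_left.2 fun x hx hx' => lt_asymm (show f x < c from hx) hx'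
  · ext x
    simp only [mem_ofPred_eq, mem_compl_iff, mem_union, not_or, not_lt]
    exact ⟨fun h => ⟨h.ge, h.le⟩, fun h => le_antisymm h.2 h.1⟩

/-- Two members of an essential family are never simultaneously separated. -/
lemma IsEssentialFamily.not_disjoint {X : Type u} [TopologicalSpace X] [NormalSpace X] {ι : Type u}
    {A B : ι → Set X} (h : IsEssentialFamily A B) {i j : ι} (hij : i ≠ j) :
    ¬ Disjoint (A i ∪ A j) (B i ∪ B j) := by
  classical
  intro hd
  obtain ⟨f, hf0, hf1, -⟩ := exists_continuous_zero_one_of_isClosed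
    ((h.isClosed_left i).union (h.isClosed_left j))
    ((h.isClosed_right i).union (h.isClosed_right j)) hd
  choose L hL using fun k => exists_isPartitionBetween (h.isClosed_left k) (h.isClosed_right k)
    (h.disjoint k)
  -- One Urysohn function serves both pairs, and two of its levels are disjoint partitions.
  have key := h.nonempty_iInter (fun k => if k = i then {x | f x = 1 / 3} else
    if k = j then {x | f x = 2 / 3} else L k) (fun k => ?_)
  · obtain ⟨x, hx⟩ := key
    have h1 := mem_iInter.1 hx i
    have h2 := mem_iInter.1 hx j
    simp only [if_true, hij.symm, if_false, mem_ofPred_eq] at h1 h2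
    norm_num [h1] at h2
  · split_ifs with h1 h2
    · subst h1
      refine isPartitionBetween_level f.continuous _ (fun x hx => ?_) (fun x hx => ?_)
      · rw [hf0 (Or.inl hx)]; norm_num
      · rw [hf1 (Or.inl hx)]; norm_num
    · subst h2
      refine isPartitionBetween_level f.continuous _ (fun x hx => ?_) (fun x hx => ?_)
      · rw [hf0 (Or.inr hx)]; norm_num
      · rw [hf1 (Or.inr hx)]; norm_num
    · exact hL k

lemma IsEssentialFamily.injective {X : Type u} [TopologicalSpace X] [NormalSpace X] {ι : Type u}
    {A B : ι → Set X} (h : IsEssentialFamily A B) : Function.Injective fun i => (A i, B i) := by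
  intro i j hij
  by_contra hne
  refine h.not_disjoint hne ?_
  simp only [Prod.mk.injEq] at hij
  rw [hij.1, hij.2, union_self, union_self]
  exact h.disjoint j

lemma exists_finset_of_isCompact_subset {X : Type u} [TopologicalSpace X] {B : Set (Set X)}
    (hB : IsTopologicalBasis B) {K U : Set X} (hK : IsCompact K) (hU : IsOpen U) (hKU : K ⊆ U) :
    ∃ P : Finset B, K ⊆ (⋃ b ∈ P, (b : Set X)) ∧ (⋃ b ∈ P, (b : Set X)) ⊆ U := by
  classical
  obtain ⟨t, ht⟩ := hK.elim_finite_subcover (fun b : {b : B // (b : Set X) ⊆ U} => (b.1 : Set X))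
    (fun b => hB.isOpen b.1.2) (fun x hx => by
      obtain ⟨b, hb, hxb, hbU⟩ := hB.exists_subset_of_mem_open (hKU hx) hU
      exact mem_iUnion.2 ⟨⟨⟨b, hb⟩, hbU⟩, hxb⟩)
  refine ⟨t.image (fun b => b.1), fun x hx => ?_, ?_⟩
  · obtain ⟨b, hb, hxb⟩ := mem_iUnion₂.1 (ht hx)
    exact mem_iUnion₂.2 ⟨b.1, Finset.mem_image_of_mem _ hb, hxb⟩
  · refine iUnion₂_subset fun b hb => ?_
    obtain ⟨c, -, rfl⟩ := Finset.mem_image.1 hb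
    exact c.2

/-- The weight of a compact space bounds the cardinality of its essential families. -/
theorem HasEssentialFamily.le_mk_basis {X : Type u} [TopologicalSpace X] [CompactSpace X]
    [T2Space X] {κ : Cardinal.{u}} (hκ : ℵ₀ ≤ κ) (h : HasEssentialFamily X κ) {B : Set (Set X)}
    (hB : IsTopologicalBasis B) : κ ≤ #B := by
  obtain ⟨ι, C, D, hι, -, hess⟩ := h
  by_contra! hlt
  have hsep : ∀ i, ∃ p : Finset B × Finset B, C i ⊆ (⋃ b ∈ p.1, (b : Set X)) ∧
      D i ⊆ (⋃ b ∈ p.2, (b : Set X)) ∧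
      Disjoint (⋃ b ∈ p.1, (b : Set X)) (⋃ b ∈ p.2, (b : Set X)) := by
    intro i
    obtain ⟨U, V, hU, hV, hCU, hDV, hUV⟩ :=
      normal_separation (hess.isClosed_left i) (hess.isClosed_right i) (hess.disjoint i)
    obtain ⟨P, hP, hP'⟩ := exists_finset_of_isCompact_subset hB (hess.isClosed_left i).isCompact
      hU hCU
    obtain ⟨R, hR, hR'⟩ := exists_finset_of_isCompact_subset hB (hess.isClosed_right i).isCompact
      hV hDV
    exact ⟨(P, R), hP, hR, hUV.mono hP' hR'⟩
  choose p hp using hsep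
  -- Fewer than κ separating pairs are available, so two indices share one, contradicting
  -- `IsEssentialFamily.not_disjoint`.
  have hcard : #(Finset B × Finset B) < #ι := by
    rw [hι, mk_prod, lift_id]
    have : #(Finset B) < κ := by
      rcases finite_or_infinite B with hfin | hinf
      · exact (lt_aleph0_of_finite _).trans_le hκ
      · rw [mk_finset_of_infinite]; exact hlt
    exact mul_lt_of_lt hκ this this
  obtain ⟨i, j, hij, hne⟩ : ∃ i j, p i = p j ∧ i ≠ j := by
    by_contra! hinj
    exact hcard.not_ge (mk_le_of_injective (f := p) fun i j h => hinj i j h)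
  refine hess.not_disjoint hne ((hp i).2.2.mono (union_subset (hp i).1 ?_)
    (union_subset (hp i).2.1 ?_))
  · rw [hij]; exact (hp j).1
  · rw [hij]; exact (hp j).2.1

lemma exists_polyFun_separating {S : Type*} {A B : Set (S → Seg)} (hA : IsClosed A)
    (hB : IsClosed B) (hAB : Disjoint A B) : ∃ q : MvPolynomial S ℚ,
      (∀ w ∈ A, polyFun q w < -1) ∧ (∀ w ∈ B, 1 < polyFun q w) := by
  obtain ⟨f, hfA, hfB, -⟩ := exists_bounded_mem_Icc_of_closed_of_le hA hB hAB
    (show (-2 : ℝ) ≤ 2 by norm_num)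
  obtain ⟨q, hq⟩ := exists_polyFun_near f.toContinuousMap (ε := 1) one_pos
  refine ⟨q, fun w hw => ?_, fun w hw => ?_⟩
  · have h1 : f w = -2 := hfA hw
    have h2 := (abs_lt.1 (hq w)).2
    have h3 : f.toContinuousMap w = f w := rfl
    linarith
  · have h1 : f w = 2 := hfB hw
    have h2 := (abs_lt.1 (hq w)).1
    have h3 : f.toContinuousMap w = f w := rfl
    linarith

/-! ### The folded core -/

/-- The roles played by the coordinates of the cube: a free coordinate, for each polynomial `q`
a coordinate folding `q`, and for each polynomial `q` the coordinates of a cube together with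
one coordinate for each finitely supported system of partitions of that cube. -/
inductive Coord (S : Type u) : Type u
  | free : Coord S
  | fold (q : MvPolynomial S ℚ) : Coord S
  | strip (q : MvPolynomial S ℚ) (α : S →₀ MvPolynomial S ℚ) : Coord S
  | cube (q : MvPolynomial S ℚ) (i : S) : Coord S

/-- The polynomials `α i` have the signs prescribed by opposite faces of the cube of `q`. -/
def SignCompatible {S : Type u} (e : Coord S ≃ S) (q : MvPolynomial S ℚ)
    (α : S →₀ MvPolynomial S ℚ) : Prop :=
  ∀ i (w : S → Seg), ((w (e (.cube q i)) : ℝ) = -2 → polyFun (α i) w ≤ 0) ∧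
    ((w (e (.cube q i)) : ℝ) = 2 → 0 ≤ polyFun (α i) w)

/-- The points of the cube whose folding coordinates fold every bounded polynomial, and on which
the `strip` coordinate of `(q, α)`, for `α` in `G`, increases with `q` in such a way that the
polynomials `α i` vanish wherever it takes an intermediate value. -/
def foldedCore {S : Type u} (e : Coord S ≃ S) (G : Set (S →₀ MvPolynomial S ℚ)) :
    Set (S → Seg) :=
  {w | ∀ q : MvPolynomial S ℚ,
    ((∀ x : S → Seg, |polyFun q x| ≤ 26) →
      4 * (w (e (.fold q)) : ℝ) ^ 3 - 3 * w (e (.fold q)) = polyFun q w) ∧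
    ∀ α ∈ G, SignCompatible e q α →
      (-1 ≤ polyFun q w ∨ (w (e (.strip q α)) : ℝ) = -2) ∧
      (polyFun q w ≤ 1 ∨ (w (e (.strip q α)) : ℝ) = 2) ∧
      ∀ i, |(w (e (.strip q α)) : ℝ)| = 2 ∨ polyFun (α i) w = 0}

lemma isClosed_foldedCore {S : Type u} (e : Coord S ≃ S) (G : Set (S →₀ MvPolynomial S ℚ)) :
    IsClosed (foldedCore e G) := by
  have hcoord : ∀ s : S, Continuous fun w : S → Seg => (w s : ℝ) := fun s => by fun_prop
  have hpoly : ∀ q : MvPolynomial S ℚ, Continuous fun w : S → Seg => polyFun q w :=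
    fun q => (polyFun q).continuous
  simp only [foldedCore, ofPred_forall, ofPred_and, ofPred_or]
  refine isClosed_iInter fun q => IsClosed.inter (isClosed_iInter fun _ => ?_)
    (isClosed_iInter fun α => isClosed_iInter fun _ => isClosed_iInter fun _ =>
      IsClosed.inter ?_ (IsClosed.inter ?_ (isClosed_iInter fun i => ?_)))
  · exact isClosed_eq (by fun_prop) (hpoly q)
  · exact (isClosed_le continuous_const (hpoly q)).union (isClosed_eq (hcoord _) continuous_const)
  · exact (isClosed_le (hpoly q) continuous_const).union (isClosed_eq (hcoord _) continuous_const)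
  · exact (isClosed_eq (hcoord _).abs continuous_const).union
      (isClosed_eq (hpoly _) continuous_const)

/-- The `k`-th of `N` consecutive steps between `-1` and `1`. -/
def stair (N k : ℕ) (x : ℝ) : ℝ := max (-2) (min 2 (4 * (N * x - k) - 2))

lemma stair_mem (N k : ℕ) (x : ℝ) : stair N k x ∈ Icc (-2 : ℝ) 2 :=
  ⟨le_max_left _ _, max_le (by norm_num) (min_le_left _ _)⟩

lemma stair_eq_of_le {N k : ℕ} {x : ℝ} (hx : N * x - k ≤ 0) : stair N k x = -2 := by
  unfold stair
  rw [max_eq_left]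
  exact (min_le_right _ _).trans (by linarith)

lemma stair_eq_of_ge {N k : ℕ} {x : ℝ} (hx : 1 ≤ N * x - k) : stair N k x = 2 := by
  unfold stair
  rw [min_eq_left (by linarith), max_eq_right (by norm_num)]

/-- A nonnegative function whose support is where `stair` takes intermediate values. -/
def bump (N k : ℕ) (x : ℝ) : ℝ := max 0 ((N * x - k) * (1 - (N * x - k)))

lemma bump_nonneg (N k : ℕ) (x : ℝ) : 0 ≤ bump N k x := le_max_left _ _

lemma bump_pos_iff {N k : ℕ} {x : ℝ} : 0 < bump N k x ↔ 0 < N * x - k ∧ N * x - k < 1 := by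
  unfold bump
  rw [lt_max_iff]
  constructor
  · rintro (h | h)
    · exact absurd h (lt_irrefl _)
    · constructor <;> nlinarith
  · rintro ⟨h1, h2⟩
    exact Or.inr (mul_pos h1 (by linarith))

lemma eq_of_bump_pos {N k l : ℕ} {x : ℝ} (hk : 0 < bump N k x) (hl : 0 < bump N l x) : k = l := by
  rw [bump_pos_iff] at hk hl
  have h1 : (k : ℝ) < l + 1 := by linarith
  have h2 : (l : ℝ) < k + 1 := by linarith
  have h1' : k < l + 1 := by exact_mod_cast h1
  have h2' : l < k + 1 := by exact_mod_cast h2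
  omega

lemma exists_mem_foldedCore_eq_zero {S : Type u} (e : Coord S ≃ S)
    (G : Finset (S →₀ MvPolynomial S ℚ)) (h : C(S → Seg, ℝ))
    (h0 : ∀ w : S → Seg, (w (e .free) : ℝ) = -2 → h w ≤ 0)
    (h1 : ∀ w : S → Seg, (w (e .free) : ℝ) = 2 → 0 ≤ h w) :
    ∃ w ∈ foldedCore e (G : Set (S →₀ MvPolynomial S ℚ)), h w = 0 := by
  classical
  have hpoly : ∀ q : MvPolynomial S ℚ, Continuous fun w : S → Seg => polyFun q w :=
    fun q => (polyFun q).continuous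
  -- Each α in G gets its own slot [k/N, (k+1)/N] of values of q.
  obtain ⟨idx, hidx, hlt⟩ : ∃ idx : (S →₀ MvPolynomial S ℚ) → ℕ,
      (∀ α ∈ G, ∀ β ∈ G, idx α = idx β → α = β) ∧ ∀ α ∈ G, idx α < G.card := by
    refine ⟨fun α => if hα : α ∈ G then G.equivFin ⟨α, hα⟩ else 0, ?_, ?_⟩
    · intro α hα β hβ hab
      simp only [hα, hβ, dif_pos] at hab
      simpa using G.equivFin.injective (Fin.ext hab)
    · intro α hα
      simp only [hα, dif_pos]
      exact Fin.is_lt _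
  set N := G.card with hN
  -- One function per coordinate. The bumps have disjoint supports, so inside the slot of a
  -- compatible α the sum for `cube q i` reduces to a positive multiple of α i.
  let H : Coord S → (S → Seg) → ℝ := fun c => match c with
    | .free => h
    | .fold q => fun w => if ∀ x : S → Seg, |polyFun q x| ≤ 26 then
        4 * (w (e (.fold q)) : ℝ) ^ 3 - 3 * w (e (.fold q)) - polyFun q w else 0
    | .strip q α => fun w => w (e (.strip q α)) - stair N (idx α) (polyFun q w)
    | .cube q i => fun w => ∑ α ∈ G.filter (SignCompatible e q),
        bump N (idx α) (polyFun q w) * polyFun (α i) w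
  have hcont : ∀ c, Continuous (H c) := by
    rintro (_ | q | ⟨q, α⟩ | ⟨q, i⟩)
    · exact h.continuous
    · simp only [H]
      split_ifs
      · have := hpoly q; fun_prop
      · fun_prop
    · have := hpoly q
      simp only [H, stair]
      fun_prop
    · have := hpoly q
      simp only [H, bump]
      refine continuous_finsetSum _ fun α _ => ?_
      have := hpoly (α i)
      fun_prop
  have hneg : ∀ c w, (w (e c) : ℝ) = -2 → H c w ≤ 0 := by
    rintro (_ | q | ⟨q, α⟩ | ⟨q, i⟩) w hw
    · exact h0 w hw
    · simp only [H]
      -- The cubic takes the values ±26 at ±2, whence the bound 26.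
      split_ifs with hb
      · have := (abs_le.1 (hb w)).1
        rw [hw]; linarith
      · exact le_rfl
    · simp only [H]
      have := (stair_mem N (idx α) (polyFun q w)).1
      rw [hw]; linarith
    · refine Finset.sum_nonpos fun α hα => ?_
      exact mul_nonpos_of_nonneg_of_nonpos (bump_nonneg _ _ _)
        (((Finset.mem_filter.1 hα).2 i w).1 hw)
  have hpos : ∀ c w, (w (e c) : ℝ) = 2 → 0 ≤ H c w := by
    rintro (_ | q | ⟨q, α⟩ | ⟨q, i⟩) w hw
    · exact h1 w hw
    · simp only [H]
      split_ifs with hb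
      · have := (abs_le.1 (hb w)).2
        rw [hw]; linarith
      · exact le_rfl
    · simp only [H]
      have := (stair_mem N (idx α) (polyFun q w)).2
      rw [hw]; linarith
    · refine Finset.sum_nonneg fun α hα => ?_
      exact mul_nonneg (bump_nonneg _ _ _) (((Finset.mem_filter.1 hα).2 i w).2 hw)
  obtain ⟨w, hw⟩ := poincare_miranda (fun s => H (e.symm s)) (fun s => hcont _)
    (fun s w hs => hneg _ w (by simpa using hs)) (fun s w hs => hpos _ w (by simpa using hs))
  have hw : ∀ c, H c w = 0 := fun c => by simpa using hw (e c)
  refine ⟨w, fun q => ⟨fun hb => ?_, fun α hα hs => ?_⟩, hw .free⟩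
  · have := hw (.fold q)
    simp only [H, if_pos hb] at this
    linarith
  · have hst : (w (e (.strip q α)) : ℝ) = stair N (idx α) (polyFun q w) := by
      have := hw (.strip q α)
      simp only [H] at this
      linarith
    have hk : (idx α : ℝ) + 1 ≤ N := by exact_mod_cast hlt α hα
    have hk0 : (0 : ℝ) ≤ idx α := Nat.cast_nonneg _
    refine ⟨?_, ?_, fun i => ?_⟩
    · rw [or_iff_not_imp_left, not_le, hst]
      intro hq
      exact stair_eq_of_le (by nlinarith)
    · rw [or_iff_not_imp_left, not_le, hst]
      intro hq
      exact stair_eq_of_ge (by nlinarith)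
    · rw [or_iff_not_imp_left, hst]
      intro hne
      have hbp : 0 < bump N (idx α) (polyFun q w) := by
        rw [bump_pos_iff]
        constructor
        · by_contra! hle
          exact hne (by rw [stair_eq_of_le hle]; norm_num)
        · by_contra! hle
          exact hne (by rw [stair_eq_of_ge hle]; norm_num)
      have hsum := hw (.cube q i)
      simp only [H] at hsum
      rw [Finset.sum_eq_single_of_mem α (Finset.mem_filter.2 ⟨hα, hs⟩)] at hsum
      · exact (mul_eq_zero.1 hsum).resolve_left hbp.ne'
      · intro β hβ hβα
        have hβG := (Finset.mem_filter.1 hβ).1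
        have : bump N (idx β) (polyFun q w) = 0 := by
          by_contra hb
          exact hβα (hidx β hβG α hα
            (eq_of_bump_pos (lt_of_le_of_ne (bump_nonneg _ _ _) (Ne.symm hb)) hbp))
        rw [this, zero_mul]

/-- Slots can be allotted to only finitely many α at once; the closed solution sets shrink as G
grows, so compactness handles all α. -/
lemma exists_mem_foldedCore_univ_eq_zero {S : Type u} (e : Coord S ≃ S) (h : C(S → Seg, ℝ))
    (h0 : ∀ w : S → Seg, (w (e .free) : ℝ) = -2 → h w ≤ 0)
    (h1 : ∀ w : S → Seg, (w (e .free) : ℝ) = 2 → 0 ≤ h w) :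
    ∃ w ∈ foldedCore e Set.univ, h w = 0 := by
  classical
  have hcl : ∀ G : Finset (S →₀ MvPolynomial S ℚ),
      IsClosed (foldedCore e (G : Set (S →₀ MvPolynomial S ℚ)) ∩ {w | h w = 0}) := fun G =>
    (isClosed_foldedCore e G).inter (isClosed_eq h.continuous continuous_const)
  have hmono : ∀ G G' : Finset (S →₀ MvPolynomial S ℚ), G ⊆ G' →
      foldedCore e (G' : Set (S →₀ MvPolynomial S ℚ)) ⊆ foldedCore e G := fun G G' hG w hw q =>
    ⟨(hw q).1, fun α hα => (hw q).2 α (hG hα)⟩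
  obtain ⟨w, hw⟩ := IsCompact.nonempty_iInter_of_directed_nonempty_isCompact_isClosed
    (fun G : Finset (S →₀ MvPolynomial S ℚ) =>
      foldedCore e (G : Set (S →₀ MvPolynomial S ℚ)) ∩ {w | h w = 0})
    (fun G G' => ⟨G ∪ G',
      inter_subset_inter_left _ (hmono _ _ Finset.subset_union_left),
      inter_subset_inter_left _ (hmono _ _ Finset.subset_union_right)⟩)
    (fun G => exists_mem_foldedCore_eq_zero e G h h0 h1)
    (fun G => (hcl G).isCompact) hcl
  rw [mem_iInter] at hw
  exact ⟨w, fun q => ⟨((hw ∅).1 q).1, fun α _ => ((hw {α}).1 q).2 α (by simp)⟩, (hw ∅).2⟩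

/-! ### A nontrivial continuum in the core -/

/-- In a compact Hausdorff space, closed sets not joined by a connected component are separated by
a clopen set. -/
lemma exists_isClopen_of_connectedComponent {X : Type*} [TopologicalSpace X] [CompactSpace X]
    [T2Space X] {A B : Set X} (hA : IsClosed A) (hB : IsClosed B)
    (h : ∀ a ∈ A, ∀ b ∈ B, b ∉ connectedComponent a) :
    ∃ Z : Set X, IsClopen Z ∧ A ⊆ Z ∧ Disjoint Z B := by
  have hc := ConnectedComponents.continuous_coe (α := X)
  obtain ⟨C, hC, hAC, hCB⟩ := exists_clopen_of_closed_subset_open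
    (hA.isCompact.image hc).isClosed (hB.isCompact.image hc).isClosed.isOpen_compl (by
      rintro _ ⟨a, ha, rfl⟩ ⟨b, hb, hba⟩
      exact h a ha b hb (ConnectedComponents.coe_eq_coe'.1 hba))
  refine ⟨_, hC.preimage hc, fun a ha => hAC ⟨a, ha, rfl⟩, ?_⟩
  rw [Set.disjoint_left]
  intro x hx hxB
  exact hCB hx ⟨x, hxB, rfl⟩

/-- If no component joined the free faces, a clopen splitting of the core would extend to a function
with the right signs on those faces and no zero on the core. -/
theorem exists_isSubcontinuum_foldedCore {S : Type u} (e : Coord S ≃ S) :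
    ∃ M ⊆ foldedCore e Set.univ, IsSubcontinuum M ∧ M.Nontrivial := by
  have hcl := isClosed_foldedCore e Set.univ
  set X := foldedCore e Set.univ with hX
  have : CompactSpace X := isCompact_iff_compactSpace.1 hcl.isCompact
  have hcoord : Continuous fun w : S → Seg => (w (e .free) : ℝ) := by fun_prop
  have hcl0 : ∀ c : ℝ, IsClosed {w : S → Seg | (w (e .free) : ℝ) = c} := fun c =>
    isClosed_eq hcoord continuous_const
  by_contra hno
  obtain ⟨Z, hZ, hAZ, hZB⟩ := exists_isClopen_of_connectedComponent
    ((hcl0 (-2)).preimage (continuous_subtype_val (p := (· ∈ X))))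
    ((hcl0 2).preimage (continuous_subtype_val (p := (· ∈ X)))) (by
      intro a ha b hb hab
      refine hno ⟨Subtype.val '' connectedComponent a, by simp,
        ⟨isClosed_connectedComponent.isCompact.image continuous_subtype_val,
          isConnected_connectedComponent.image _ continuous_subtype_val.continuousOn⟩,
        ⟨a, ⟨a, mem_connectedComponent, rfl⟩, b, ⟨b, hab, rfl⟩, fun hEq => ?_⟩⟩
      have h1 : ((a : S → Seg) (e .free) : ℝ) = -2 := ha
      have h2 : ((b : S → Seg) (e .free) : ℝ) = 2 := hb
      rw [hEq, h2] at h1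
      norm_num at h1)
  have hZc : IsClosed (Subtype.val '' Z) := hcl.isClosedEmbedding_subtypeVal.isClosedMap _ hZ.1
  have hZc' : IsClosed (Subtype.val '' Zᶜ) :=
    hcl.isClosedEmbedding_subtypeVal.isClosedMap _ hZ.2.isClosed_compl
  obtain ⟨f, hf0, hf1, -⟩ := exists_bounded_mem_Icc_of_closed_of_le
    (hZc.union (hcl0 (-2))) (hZc'.union (hcl0 2)) (by
      rw [Set.disjoint_left]
      rintro w (⟨x, hx, rfl⟩ | hw) (⟨y, hy, hyx⟩ | hw')
      · rw [Subtype.ext hyx] at hy; exact hy hx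
      · exact Set.disjoint_left.1 hZB hx hw'
      · subst hyx; exact hy (hAZ hw)
      · have h1 : (w (e .free) : ℝ) = -2 := hw
        have h2 : (w (e .free) : ℝ) = 2 := hw'
        rw [h2] at h1
        norm_num at h1) (show (-1 : ℝ) ≤ 1 by norm_num)
  have hfm : ∀ w, w ∈ Subtype.val '' Z ∪ {w : S → Seg | (w (e .free) : ℝ) = -2} → f w = -1 :=
    fun w hw => hf0 hw
  have hfp : ∀ w, w ∈ Subtype.val '' Zᶜ ∪ {w : S → Seg | (w (e .free) : ℝ) = 2} → f w = 1 :=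
    fun w hw => hf1 hw
  obtain ⟨w, hw, hfw⟩ := exists_mem_foldedCore_univ_eq_zero e f.toContinuousMap
    (fun w hw => by
      have : f.toContinuousMap w = -1 := hfm w (Or.inr hw)
      rw [this]; norm_num)
    (fun w hw => by
      have : f.toContinuousMap w = 1 := hfp w (Or.inr hw)
      rw [this]; norm_num)
  have hfw : f w = 0 := hfw
  by_cases hwZ : (⟨w, hw⟩ : X) ∈ Z
  · rw [hfm w (Or.inl ⟨_, hwZ, rfl⟩)] at hfw; norm_num at hfw
  · rw [hfp w (Or.inl ⟨_, hwZ, rfl⟩)] at hfw; norm_num at hfw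

/-! ### Hereditary indecomposability and essential families in the core -/

/-- Two subcontinua of the folded core that meet are nested. -/
theorem subset_or_subset_of_subset_foldedCore {S : Type u} (e : Coord S ≃ S) {K M : Set (S → Seg)}
    (hK : IsSubcontinuum K) (hM : IsSubcontinuum M) (hKX : K ⊆ foldedCore e Set.univ)
    (hMX : M ⊆ foldedCore e Set.univ) (hKM : (K ∩ M).Nonempty) : K ⊆ M ∨ M ⊆ K := by
  by_contra! hcon
  obtain ⟨⟨a, haK, haM⟩, ⟨b, hbM, hbK⟩⟩ :=
    And.intro (not_subset.1 hcon.1) (not_subset.1 hcon.2)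
  obtain ⟨c, hcK, hcM⟩ := hKM
  obtain ⟨f, hfM, hfa, hf⟩ := exists_bounded_mem_Icc_of_closed_of_le hM.1.isClosed
    (isClosed_singleton (x := a)) (Set.disjoint_singleton_right.2 haM)
    (show (0 : ℝ) ≤ 2 by norm_num)
  obtain ⟨g, hgK, hgb, hg⟩ := exists_bounded_mem_Icc_of_closed_of_le hK.1.isClosed
    (isClosed_singleton (x := b)) (Set.disjoint_singleton_right.2 hbK)
    (show (0 : ℝ) ≤ 2 by norm_num)
  -- This q is below 1 on K, above -1 on M, below -1 at a and above 1 at b.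
  obtain ⟨q, hq⟩ := exists_polyFun_near (g.toContinuousMap - f.toContinuousMap) (ε := 1) one_pos
  have hq : ∀ w, |polyFun q w - (g w - f w)| < 1 := hq
  have hfM : ∀ w ∈ M, f w = 0 := fun w hw => hfM hw
  have hgK : ∀ w ∈ K, g w = 0 := fun w hw => hgK hw
  have hfa : f a = 2 := hfa rfl
  have hgb : g b = 2 := hgb rfl
  have hbound : ∀ x, |polyFun q x| ≤ 26 := fun x => by
    have h1 := abs_lt.1 (hq x)
    have h2 := hf x
    have h3 := hg x
    rw [abs_le]
    constructor <;> linarith [h1.1, h1.2, h2.1, h2.2, h3.1, h3.2]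
  set t : (S → Seg) → ℝ := fun w => w (e (.fold q)) with ht
  have htc : Continuous t := by simp only [ht]; fun_prop
  have hfold : ∀ w ∈ foldedCore e Set.univ, 4 * t w ^ 3 - 3 * t w = polyFun q w :=
    fun w hw => (hw q).1 hbound
  have hta : t a < -1 := by
    have h1 := hfold a (hKX haK)
    have h2 := (abs_lt.1 (hq a)).2
    rw [hgK a haK, hfa] at h2
    by_contra! h3
    -- 4t³ - 3t + 1 = (t + 1)(2t - 1)².
    nlinarith [mul_nonneg (show 0 ≤ t a + 1 by linarith) (sq_nonneg (2 * t a - 1))]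
  have htb : 1 < t b := by
    have h1 := hfold b (hMX hbM)
    have h2 := (abs_lt.1 (hq b)).1
    rw [hfM b hbM, hgb] at h2
    by_contra! h3
    nlinarith [mul_nonneg (show 0 ≤ 1 - t b by linarith) (sq_nonneg (2 * t b + 1))]
  -- At t = -1/2 the cubic has its local maximum 1, which q does not reach on K; so K stays on the
  -- left branch. Symmetrically M stays to the right of 1/2, yet both contain c.
  have htK : t c < -(1 / 2) := by
    by_contra! h
    obtain ⟨w, hw, htw⟩ := hK.2.isPreconnected.intermediate_value haK hcK htc.continuousOn
      (show -(1 / 2) ∈ Icc (t a) (t c) from ⟨by linarith, h⟩)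
    have h1 := hfold w (hKX hw)
    have h2 := (abs_lt.1 (hq w)).2
    rw [hgK w hw] at h2
    rw [htw] at h1
    linarith [(hf w).1]
  have htM : 1 / 2 < t c := by
    by_contra! h
    obtain ⟨w, hw, htw⟩ := hM.2.isPreconnected.intermediate_value hcM hbM htc.continuousOn
      (show 1 / 2 ∈ Icc (t c) (t b) from ⟨h, by linarith⟩)
    have h1 := hfold w (hMX hw)
    have h2 := (abs_lt.1 (hq w)).1
    rw [hfM w hw] at h2
    rw [htw] at h1
    linarith [(hg w).1]
  linarith

/-- Every nontrivial continuum in the folded core has an essential family as large as the set of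
coordinates. -/
theorem hasEssentialFamily_of_mem_foldedCore {S : Type u} (e : Coord S ≃ S) {Y : Type u}
    [TopologicalSpace Y] [CompactSpace Y] [T2Space Y] [PreconnectedSpace Y] [Nontrivial Y]
    {φ : Y → S → Seg} (hφ : Continuous φ) (hinj : Function.Injective φ)
    (hmem : ∀ y, φ y ∈ foldedCore e Set.univ) : HasEssentialFamily Y #S := by
  classical
  obtain ⟨a, b, hab⟩ := exists_pair_ne Y
  -- Any q separating two points of Y selects the cube whose faces are essential.
  obtain ⟨q, hqa, hqb⟩ := exists_polyFun_separating (isClosed_singleton (x := φ a))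
    (isClosed_singleton (x := φ b)) (by simpa using hinj.ne hab)
  have hqa := hqa _ rfl
  have hqb := hqb _ rfl
  have hemb : Topology.IsClosedEmbedding φ := hφ.isClosedEmbedding hinj
  let face : ℝ → S → Set (S → Seg) := fun c i => {w | (w (e (.cube q i)) : ℝ) = c}
  have hface : ∀ c i, IsClosed (face c i) := fun c i =>
    isClosed_eq (by fun_prop) continuous_const
  have hdisj : ∀ i, Disjoint (face (-2) i) (face 2 i) := by
    intro i
    rw [Set.disjoint_left]
    intro w h1 h2
    have h1 : (w (e (.cube q i)) : ℝ) = -2 := h1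
    have h2 : (w (e (.cube q i)) : ℝ) = 2 := h2
    rw [h1] at h2
    norm_num at h2
  have hess : IsEssentialFamily (fun i => φ ⁻¹' face (-2) i) (fun i => φ ⁻¹' face 2 i) := by
    refine ⟨fun i => (hface _ i).preimage hφ, fun i => (hface _ i).preimage hφ,
      fun i => (hdisj i).preimage φ, fun L hL => ?_⟩
    choose U V hU hV hAU hBV hUV hLU using hL
    by_contra hemp
    rw [Set.not_nonempty_iff_eq_empty] at hemp
    obtain ⟨F, hF⟩ := isCompact_univ.elim_finite_subcover (fun i => U i ∪ V i)
      (fun i => (hU i).union (hV i)) (fun y _ => by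
        by_contra hy
        have : y ∈ ⋂ i, L i := mem_iInter.2 fun i => by
          rw [hLU]
          exact fun h => hy (mem_iUnion.2 ⟨i, h⟩)
        rw [hemp] at this
        exact this)
    obtain ⟨E, hE, hEc, hEsub⟩ := exists_iUnion_eq_closed_subset
      (u := fun i : F => U i ∪ V i) (fun i => (hU i).union (hV i)) (fun x => Set.toFinite _) (by
        refine Set.eq_univ_of_univ_subset fun y hy => ?_
        obtain ⟨i, hi, hyi⟩ := mem_iUnion₂.1 (hF hy)
        exact mem_iUnion.2 ⟨⟨i, hi⟩, hyi⟩)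
    -- E i lies in the disjoint union of U i and V i, so |p| > 1 on its image; including the faces
    -- gives sign compatibility on the whole cube.
    have hpol : ∀ i : F, ∃ p : MvPolynomial S ℚ,
        (∀ w ∈ φ '' (E i \ V i) ∪ face (-2) i, polyFun p w < -1) ∧
        (∀ w ∈ φ '' (E i \ U i) ∪ face 2 i, 1 < polyFun p w) := by
      intro i
      refine exists_polyFun_separating
        ((hemb.isClosedMap _ ((hEc i).sdiff (hV i))).union (hface _ _))
        ((hemb.isClosedMap _ ((hEc i).sdiff (hU i))).union (hface _ _)) ?_
      rw [Set.disjoint_left]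
      rintro w (⟨x, ⟨hx, hxV⟩, rfl⟩ | hw) (⟨y, ⟨hy, hyU⟩, hyx⟩ | hw')
      · obtain rfl := hinj hyx
        exact (hEsub i hx).elim hyU hxV
      · exact hxV (hBV i hw')
      · subst hyx; exact hyU (hAU i hw)
      · exact Set.disjoint_left.1 (hdisj i) hw hw'
    choose p hpm hpp using hpol
    let α : S →₀ MvPolynomial S ℚ := Finsupp.indicator F fun i hi => p ⟨i, hi⟩
    have hα : ∀ i (hi : i ∈ F), α i = p ⟨i, hi⟩ := fun i hi => Finsupp.indicator_of_mem hi _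
    have hcomp : SignCompatible e q α := by
      intro i w
      by_cases hi : i ∈ F
      · rw [hα i hi]
        exact ⟨fun hw => by linarith [hpm ⟨i, hi⟩ w (Or.inr hw)],
          fun hw => by linarith [hpp ⟨i, hi⟩ w (Or.inr hw)]⟩
      · have : α i = 0 := Finsupp.indicator_of_notMem hi _
        rw [this, map_zero]
        exact ⟨fun _ => le_rfl, fun _ => le_rfl⟩
    have hstrip := fun y => (hmem y q).2 α (mem_univ _) hcomp
    have hsa := (hstrip a).1.resolve_left (by linarith)
    have hsb := (hstrip b).2.1.resolve_left (by linarith)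
    -- Where the strip coordinate is 0 every α i vanishes, but y lies in some E i, where α i cannot.
    obtain ⟨y, -, hy⟩ := isPreconnected_univ.intermediate_value (mem_univ a) (mem_univ b)
      (f := fun y => (φ y (e (.strip q α)) : ℝ)) (by fun_prop)
      (show (0 : ℝ) ∈ Icc _ _ by simp only [hsa, hsb]; norm_num)
    simp only at hy
    have hyE : y ∈ ⋃ i, E i := by rw [hE]; trivial
    obtain ⟨⟨i, hi⟩, hyi⟩ := mem_iUnion.1 hyE
    have hzero := ((hstrip y).2.2 i).resolve_left (by rw [hy]; norm_num)
    rw [hα i hi] at hzero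
    rcases hEsub _ hyi with h | h
    · have := hpm ⟨i, hi⟩ (φ y)
        (Or.inl ⟨y, ⟨hyi, fun h' => Set.disjoint_left.1 (hUV i) h h'⟩, rfl⟩)
      linarith
    · have := hpp ⟨i, hi⟩ (φ y)
        (Or.inl ⟨y, ⟨hyi, fun h' => Set.disjoint_left.1 (hUV i) h' h⟩, rfl⟩)
      linarith
  exact ⟨S, _, _, rfl, hess.injective, hess⟩

/-! ### Cardinalities and conclusion -/

lemma mk_mvPolynomial_rat_le {S : Type u} (hS : ℵ₀ ≤ #S) : #(MvPolynomial S ℚ) ≤ #S := by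
  refine MvPolynomial.cardinalMk_le_max_lift.trans ?_
  simp [hS]

/-- Finite support of α is essential: arbitrary families of polynomials would be too many. -/
lemma exists_equiv_coord {S : Type u} (hS : ℵ₀ ≤ #S) : Nonempty (Coord S ≃ S) := by
  have : Infinite S := infinite_iff.2 hS
  rw [← Cardinal.eq]
  refine le_antisymm ?_ (mk_le_of_injective (f := Coord.cube 0) fun i j h => by simpa using h)
  let F : Option (MvPolynomial S ℚ ⊕ (MvPolynomial S ℚ × (S →₀ MvPolynomial S ℚ)) ⊕
      (MvPolynomial S ℚ × S)) → Coord S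
    | none => .free
    | some (.inl q) => .fold q
    | some (.inr (.inl p)) => .strip p.1 p.2
    | some (.inr (.inr p)) => .cube p.1 p.2
  have hF : Function.Surjective F := by
    rintro (_ | q | ⟨q, α⟩ | ⟨q, i⟩)
    exacts [⟨none, rfl⟩, ⟨some (.inl q), rfl⟩, ⟨some (.inr (.inl (q, α))), rfl⟩,
      ⟨some (.inr (.inr (q, i))), rfl⟩]
  have hQ := mk_mvPolynomial_rat_le hS
  have hfs : #(S →₀ MvPolynomial S ℚ) ≤ #S := by
    rw [mk_finsupp_of_infinite]
    exact max_le le_rfl hQ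
  refine (mk_le_of_surjective hF).trans ?_
  rw [mk_option, mk_sum, mk_sum, mk_prod, mk_prod]
  simp only [lift_id]
  refine add_le_of_le hS (add_le_of_le hS hQ (add_le_of_le hS ?_ ?_)) (one_le_aleph0.trans hS)
  · exact (mul_le_mul' hQ hfs).trans (mul_eq_self hS).le
  · exact (mul_le_mul' hQ le_rfl).trans (mul_eq_self hS).le

lemma TopologicalSpace.IsTopologicalBasis.topWeight_le {X : Type u} [TopologicalSpace X]
    {B : Set (Set X)} (hB : IsTopologicalBasis B) : topWeight X ≤ #B :=
  csInf_le (OrderBot.bddBelow _) ⟨B, hB, rfl⟩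

/-- Polynomials separate points from closed sets, so their positivity sets form a base. -/
lemma topWeight_subtype_le {S : Type u} (hS : ℵ₀ ≤ #S) (M : Set (S → Seg)) :
    topWeight M ≤ #S := by
  let B : MvPolynomial S ℚ → Set M := fun q => {x | 0 < polyFun q x}
  have hB : IsTopologicalBasis (Set.range B) := by
    refine isTopologicalBasis_of_isOpen_of_nhds ?_ ?_
    · rintro _ ⟨q, rfl⟩
      exact isOpen_lt continuous_const ((polyFun q).continuous.comp continuous_subtype_val)
    · intro x U hx hU
      obtain ⟨V, hV, rfl⟩ := isOpen_induced_iff.1 hU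
      obtain ⟨q, hq1, hq2⟩ := exists_polyFun_separating hV.isClosed_compl
        (isClosed_singleton (x := (x : S → Seg))) (by simpa using hx)
      refine ⟨_, ⟨q, rfl⟩, ?_, fun y hy => ?_⟩
      · exact one_pos.trans (hq2 _ rfl)
      · by_contra hyV
        have h1 := hq1 _ hyV
        have h2 : 0 < polyFun q y := hy
        linarith
  exact hB.topWeight_le.trans (mk_range_le.trans (mk_mvPolynomial_rat_le hS))

theorem exists_of_aleph0_le {κ : Cardinal.{u}} (hκ : ℵ₀ ≤ κ) :
    ∃ (X : Type u) (_ : TopologicalSpace X),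
      CompactSpace X ∧ T2Space X ∧
      HereditarilyIndecomposable X ∧
      topWeight X = κ ∧
      (∀ C : Set X, IsSubcontinuum C → C.Nontrivial → HasEssentialFamily C κ) ∧
      ConnectedSpace X ∧ Nontrivial X := by
  obtain ⟨S, rfl⟩ : ∃ S : Type u, #S = κ := ⟨κ.out, mk_out κ⟩
  obtain ⟨e⟩ := exists_equiv_coord hκ
  obtain ⟨M, hMX, hM, hMn⟩ := exists_isSubcontinuum_foldedCore e
  have : CompactSpace M := isCompact_iff_compactSpace.1 hM.1
  have : ConnectedSpace M := isConnected_iff_connectedSpace.1 hM.2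
  have : Nontrivial M := hMn.coe_sort
  refine ⟨M, inferInstance, inferInstance, inferInstance, ?_, le_antisymm
    (topWeight_subtype_le hκ M) ?_, ?_, inferInstance, inferInstance⟩
  · intro C D hC hD hCD
    have himg : ∀ C : Set M, IsSubcontinuum C → IsSubcontinuum (Subtype.val '' C) := fun C hC =>
      ⟨hC.1.image continuous_subtype_val, hC.2.image _ continuous_subtype_val.continuousOn⟩
    have hsub : ∀ C : Set M, Subtype.val '' C ⊆ foldedCore e Set.univ := fun C =>
      (by rintro _ ⟨x, -, rfl⟩; exact hMX x.2)
    have := subset_or_subset_of_subset_foldedCore e (himg C hC) (himg D hD) (hsub C) (hsub D)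
      (by obtain ⟨x, hx⟩ := hCD; exact ⟨x, ⟨x, hx.1, rfl⟩, ⟨x, hx.2, rfl⟩⟩)
    simpa only [Set.image_subset_image_iff Subtype.val_injective] using this
  -- M is itself a nontrivial continuum in the core, and its essential family bounds the weight
  -- below.
  · have hess : HasEssentialFamily M #S := hasEssentialFamily_of_mem_foldedCore e
      continuous_subtype_val Subtype.val_injective fun y => hMX y.2
    refine le_csInf ⟨_, _, isTopologicalBasis_opens, rfl⟩ ?_
    rintro _ ⟨B, hB, rfl⟩
    exact hess.le_mk_basis hκ hB
  · intro C hC hCn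
    have : CompactSpace C := isCompact_iff_compactSpace.1 hC.1
    have : ConnectedSpace C := isConnected_iff_connectedSpace.1 hC.2
    have : Nontrivial C := hCn.coe_sort
    exact hasEssentialFamily_of_mem_foldedCore e
      (continuous_subtype_val.comp continuous_subtype_val)
      (Subtype.val_injective.comp Subtype.val_injective) fun y => hMX y.1.2

/-- The weight of a discrete space is its cardinality. -/
lemma topWeight_of_discreteTopology (X : Type u) [TopologicalSpace X] [DiscreteTopology X] :
    topWeight X = #X := by
  refine le_antisymm ?_ (le_csInf ⟨_, _, isTopologicalBasis_opens, rfl⟩ ?_)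
  · refine (isTopologicalBasis_singletons X).topWeight_le.trans ?_
    exact mk_le_of_surjective (f := fun x : X => (⟨{x}, x, rfl⟩ : {s : Set X | ∃ x, s = {x}})) (by
      rintro ⟨_, x, rfl⟩; exact ⟨x, rfl⟩)
  · rintro _ ⟨B, hB, rfl⟩
    refine mk_le_of_injective (f := fun x : X => (⟨{x}, ?_⟩ : B)) fun x y h => by simpa using h
    obtain ⟨b, hb, hxb, hbx⟩ := hB.exists_subset_of_mem_open (mem_singleton x)
      (isOpen_discrete {x})
    rwa [Set.Subset.antisymm hbx (Set.singleton_subset_iff.2 hxb)] at hb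

theorem mainTheorem3 (κ : Cardinal.{u}) :
    ∃ (X : Type u) (_ : TopologicalSpace X),
      CompactSpace X ∧ T2Space X ∧
      HereditarilyIndecomposable X ∧
      topWeight X = κ ∧
      (∀ C : Set X, IsSubcontinuum C → C.Nontrivial → HasEssentialFamily C κ) ∧
      (ℵ₀ ≤ κ → ConnectedSpace X ∧ Nontrivial X) := by
  rcases le_or_gt ℵ₀ κ with hκ | hκ
  · obtain ⟨X, hX, h1, h2, h3, h4, h5, h6⟩ := exists_of_aleph0_le hκ
    exact ⟨X, hX, h1, h2, h3, h4, h5, fun _ => h6⟩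
  · obtain ⟨X, rfl⟩ : ∃ X : Type u, #X = κ := ⟨κ.out, mk_out κ⟩
    have : Finite X := lt_aleph0_iff_finite.1 hκ
    -- A discrete space has no nontrivial subcontinua, so the condition on them is vacuous.
    let _ : TopologicalSpace X := ⊥
    have : DiscreteTopology X := ⟨rfl⟩
    have hsub : ∀ C : Set X, IsSubcontinuum C → C.Subsingleton := fun C hC =>
      hC.2.isPreconnected.subsingleton
    refine ⟨X, ⊥, inferInstance, inferInstance, ?_, topWeight_of_discreteTopology X,
      fun C hC hn => absurd (hsub C hC) (Set.not_subsingleton_iff.2 hn),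
      fun h => absurd h hκ.not_ge⟩
    rintro C D hC hD ⟨x, hxC, hxD⟩
    refine Or.inl fun y hy => ?_
    rwa [hsub C hC hy hxC]
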